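/- All graphs are finite. A signed graph $G=(V,E,s)$ is a simple graph $(V,E)$ (no loops, no parallel edges) with a signature $s:E\to\{-1,+1\}$; a closed walk is balanced if it has an even number of negative edges (counted with multiplicity). A homomorphism from a signed graph $G$ to a signed graph $H$ is a map $\varphi:V(G)\to V(H)$ that sends every edge of $G$ to an edge of $H$ and every closed walk of $G$ to a closed walk of $H$ of the same balance. The chromatic number $\chi_s(G)$ is the smallest order of a signed graph $H$ to which $G$ admits a homomorphism, and for a class $\mathcal C$ of signed graphs $\chi_s(\mathcal C)=\sup_{G\in\mathcal C}\chi_s(G)$. The maximum average degree of a graph is the maximum of $2|E(H)|/|V(H)|$ over its nonempty subgraphs $H$ (and $0$ if the graph has no vertices), and $\mathcal M_k$ denotes the class of signed graphs with maximum average degree less than $k$. Let $SP_9$ be the signed graph with vertex set $\mathbb F_9$ in which any two distinct vertices $u,v$ are joined by an edge, which is positive if $u-v$ is a square in $\mathbb F_9$ and negative otherwise, and let $SP_9^+$ be the signed graph on $10$ vertices obtained from $SP_9$ by adding one vertex joined by a positive edge to every other vertex. Theorem. Every signed graph with maximum average degree less than $\frac{17}{5}$ admits a homomorphism to $SP_9^+$.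 That is, $\chi_s(\mathcal M_{17/5})\le 10$. -/

import Mathlib

universe u v w

/-- A signed graph on the vertex set `V`: a simple graph (no loops, no parallel edges) together with
a signature, which assigns to every edge a sign in `{-1, +1}`. -/
structure SignedGraph (V : Type u) where
  /-- The underlying simple graph. -/
  graph : SimpleGraph V
  /-- The signature. -/
  sign : graph.edgeSet → ℤˣ

namespace SignedGraph

/-- The sign of the edge `uv`. -/
def edgeSign {V : Type u} (G : SignedGraph V) {a b : V} (h : G.graph.Adj a b) : ℤˣ :=
  G.sign ⟨s(a, b), G.graph.mem_edgeSet.2 h⟩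

/-- The number of negative edges of a walk, counted with multiplicity. -/
def negCount {V : Type u} (G : SignedGraph V) : {a b : V} → G.graph.Walk a b → ℕ
  | _, _, .nil => 0
  | _, _, .cons h p => (if G.edgeSign h = -1 then 1 else 0) + negCount G p

/-- A walk is balanced if it has an even number of negative edges. -/
def IsBalanced {V : Type u} (G : SignedGraph V) {a b : V} (p : G.graph.Walk a b) : Prop :=
  Even (G.negCount p)

/-- `G` admits a homomorphism to `H`: a map of the vertices that preserves adjacency and maps every
closed walk of `G` to a closed walk of `H` of the same balance. -/
def HomTo {V : Type u} {W : Type v} (G : SignedGraph V) (H : SignedGraph W) : Prop :=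
  ∃ φ : G.graph →g H.graph,
    ∀ (a : V) (p : G.graph.Walk a a), H.IsBalanced (p.map φ) ↔ G.IsBalanced p

/-- The chromatic number of a signed graph: the smallest order of a signed graph
to which it admits a homomorphism. -/
noncomputable def chromaticNumber {V : Type u} (G : SignedGraph V) : ℕ∞ :=
  ⨅ (n : ℕ) (_ : ∃ H : SignedGraph (Fin n), G.HomTo H), (n : ℕ∞)

/-- The chromatic number of a class of (finite) signed graphs: the supremum of the chromatic numbers
of its finite members. -/
noncomputable def classChromaticNumber (C : ∀ V : Type u, SignedGraph V → Prop) : ℕ∞ :=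
  ⨆ (V : Type u) (_ : Finite V) (G : SignedGraph V) (_ : C V G), G.chromaticNumber

/-- The signed Paley graph on a finite field `F` with `|F| ≡ 1 (mod 4)`: any two distinct
elements `a`, `b` are adjacent, with a positive edge if `a - b` is a square and with a negative edge
otherwise. -/
noncomputable def paley (F : Type u) [Field F] [Fintype F] (hF : Fintype.card F % 4 = 1) :
    SignedGraph F where
  graph := ⊤
  sign e := by
    classical
    exact Sym2.lift ⟨fun a b : F => if IsSquare (a - b) then (1 : ℤˣ) else -1, fun a b => by
      have h1 : IsSquare (-1 : F) := FiniteField.isSquare_neg_one_iff.2 (by omega)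
      have h2 : IsSquare (a - b) ↔ IsSquare (b - a) :=
        ⟨fun h => by simpa using h1.mul h, fun h => by simpa using h1.mul h⟩
      simp only [h2]⟩ e.1

/-- The simple graph obtained by adding a vertex adjacent to all other vertices. -/
def addUniversalGraph {V : Type u} (G : SimpleGraph V) : SimpleGraph (Option V) where
  Adj
    | none, none => False
    | none, some _ => True
    | some _, none => True
    | some a, some b => G.Adj a b
  symm := ⟨by
    rintro (_ | a) (_ | b) h
    · exact h
    · trivial
    · trivial
    · exact SimpleGraph.Adj.symm (G := G) h⟩
  loopless := ⟨by
    rintro (_ | a) h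
    · exact h
    · exact G.irrefl h⟩

/-- The signed graph `G⁺` obtained from `G` by adding a vertex (`none`) that is joined by a positive
edge to every other vertex: its negative edges are exactly those of `G`. -/
noncomputable def plus {V : Type u} (G : SignedGraph V) : SignedGraph (Option V) where
  graph := addUniversalGraph G.graph
  sign e := by
    classical
    exact if ∃ (a b : V) (h : G.graph.Adj a b), e.1 = s(some a, some b) ∧ G.edgeSign h = -1
      then -1 else 1

/-- The field with nine elements. -/
abbrev F9 : Type := GaloisField 3 2

noncomputable instance : Fintype F9 := Fintype.ofFinite F9

theorem card_F9 : Fintype.card F9 = 9 := by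
  rw [← Nat.card_eq_fintype_card, GaloisField.card 3 2 (by norm_num)]
  norm_num

/-- The signed graph `SP₉⁺`. -/
noncomputable def SP9plus : SignedGraph (Option F9) :=
  (paley F9 (by rw [card_F9])).plus

end SignedGraph

/-- The average degree `2|E(H)| / |V(H)|` of a (finite, nonempty) subgraph `H`. -/
noncomputable def SimpleGraph.Subgraph.averageDegree {V : Type u} {G : SimpleGraph V}
    (H : G.Subgraph) : ℝ :=
  2 * (H.edgeSet.ncard : ℝ) / (H.verts.ncard : ℝ)

/-- The maximum average degree of a finite graph: the maximum of the average degrees of its nonempty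
subgraphs (a finite family). -/
noncomputable def SimpleGraph.maxAverageDegree {V : Type u} (G : SimpleGraph V) : ℝ :=
  ⨆ H : {H : G.Subgraph // H.verts.Nonempty}, H.1.averageDegree

/-- The class of signed graphs with maximum average degree less than `k`. -/
def SignedGraph.MadLT (k : ℝ) (V : Type u) (G : SignedGraph V) : Prop :=
  G.graph.maxAverageDegree < k

namespace SignedColour

/-! ### The antitwinned graph of `SP₉⁺` -/

/-- The rows of the adjacency matrix of the antitwinned graph of `SP₉⁺`, as bit masks. The colour
`c < 20` stands for the position `c % 10` with the sign given by `10 ≤ c`. -/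
def nbMask (c : ℕ) : ℕ :=
  [442958, 369301, 221987, 399985, 333482, 200476, 56201, 46930, 28388, 511, 604592, 677224,
    822488, 640390, 698693, 815299, 926774, 870445, 757787, 523264].getD c 0

/-- Two colours are joined by a positive edge. -/
def rel (c d : Fin 20) : Bool := (nbMask c).testBit d

/-- The antitwin of a colour. -/
def anti (c : Fin 20) : Fin 20 := c + 10

/-- Replace a colour by its antitwin if the sign is negative (`true`). -/
def twist (s : Bool) (c : Fin 20) : Fin 20 := if s then anti c else c

/-- The neighbours of a colour by positive edges. -/
def nb (c : Fin 20) : Finset (Fin 20) := Finset.univ.filter fun d => rel c d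

theorem mem_nb {c d : Fin 20} : d ∈ nb c ↔ rel c d = true := by simp [nb]

theorem rel_comm : ∀ c d : Fin 20, rel c d = rel d c := by decide +kernel

theorem rel_twist_left : ∀ (s : Bool) (c d : Fin 20), rel (twist s c) d = rel c (twist s d) := by
  decide +kernel

theorem twist_twist : ∀ (s t : Bool) (c : Fin 20), twist s (twist t c) = twist (xor s t) c := by
  decide +kernel

theorem twist_self : ∀ (s : Bool) (c : Fin 20), twist s (twist s c) = c := by
  decide +kernel

theorem twist_injective (s : Bool) : Function.Injective (twist s) := fun a b h => by
  rw [← twist_self s a, h, twist_self]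

theorem anti_anti : ∀ c : Fin 20, anti (anti c) = c := by decide +kernel

theorem twist_ne_anti_of_rel : ∀ (s a b : Bool) (c d : Fin 20), rel c (twist s d) = true →
    twist a c ≠ anti (twist b d) := by
  decide +kernel

theorem ne_anti_of_common : ∀ w c d : Fin 20, rel w c = true → rel w d = true → c ≠ anti d := by
  decide +kernel

theorem card_nb : ∀ c : Fin 20, (nb c).card = 9 := by decide +kernel

theorem four_le_card_nb_inter : ∀ a b : Fin 20, a ≠ anti b → 4 ≤ (nb a ∩ nb b).card := by
  decide +kernel

theorem exists_common_three_mask : ∀ a b c : Fin 20, a ≠ anti b → a ≠ anti c → b ≠ anti c →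
    nbMask a &&& nbMask b &&& nbMask c ≠ 0 := by
  decide +kernel

theorem card_nb_inter_le : ∀ a b : Fin 20, a ≠ b → (nb a ∩ nb b).card ≤ 4 := by
  decide +kernel

theorem rel_anti_right : ∀ a b : Fin 20, rel a b = true → rel a (anti b) = false := by
  decide +kernel

theorem nbMask_lt : ∀ c : Fin 20, nbMask c < 2 ^ 20 := by decide +kernel

theorem exists_common_three {a b c : Fin 20} (hab : a ≠ anti b) (hac : a ≠ anti c)
    (hbc : b ≠ anti c) : ∃ w, rel w a = true ∧ rel w b = true ∧ rel w c = true := by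
  by_contra! h
  apply exists_common_three_mask a b c hab hac hbc
  apply Nat.eq_of_testBit_eq
  intro i
  by_cases hi : i < 20
  · have := h ⟨i, hi⟩
    rw [rel_comm _ a, rel_comm _ b, rel_comm _ c] at this
    simp only [rel] at this
    simp only [Nat.testBit_and, Nat.zero_testBit]
    grind
  · have : (nbMask a).testBit i = false :=
      Nat.testBit_eq_false_of_lt ((nbMask_lt a).trans_le (Nat.pow_le_pow_right (by norm_num)
        (by omega)))
    simp [this]

theorem card_nb_inter {a b : Fin 20} (hab : a ≠ b) (hab' : a ≠ anti b) :
    (nb a ∩ nb b).card = 4 :=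
  le_antisymm (card_nb_inter_le a b hab) (four_le_card_nb_inter a b hab')

/-- The number of colours that are adjacent to none of three given colours. -/
theorem card_compl_union_three {a b c : Fin 20} (hab : a ≠ b) (hac : a ≠ c) (hbc : b ≠ c)
    (hab' : a ≠ anti b) (hac' : a ≠ anti c) (hbc' : b ≠ anti c) :
    (nb a ∪ nb b ∪ nb c)ᶜ.card + (nb a ∩ nb b ∩ nb c).card = 5 := by
  have h1 := Finset.card_union_add_card_inter (nb a ∪ nb b) (nb c)
  have h2 := Finset.card_union_add_card_inter (nb a) (nb b)
  rw [Finset.union_inter_distrib_right] at h1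
  have h3 := Finset.card_union_add_card_inter (nb a ∩ nb c) (nb b ∩ nb c)
  have h4 : nb a ∩ nb c ∩ (nb b ∩ nb c) = nb a ∩ nb b ∩ nb c := by
    ext; simp only [Finset.mem_inter]; tauto
  have h5 := Finset.card_compl_add_card (nb a ∪ nb b ∪ nb c)
  rw [h4, card_nb_inter hac hac', card_nb_inter hbc hbc'] at h3
  rw [card_nb_inter hab hab', card_nb, card_nb] at h2
  rw [card_nb] at h1
  simp only [Fintype.card_fin] at h5
  omega

theorem card_common_three_le {a b c : Fin 20} (hab : a ≠ b) (hac : a ≠ c) (hbc : b ≠ c)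
    (hab' : a ≠ anti b) (hac' : a ≠ anti c) (hbc' : b ≠ anti c) :
    (nb a ∩ nb b ∩ nb c).card ≤ 2 := by
  have h := card_compl_union_three hab hac hbc hab' hac' hbc'
  have h2 : (nb a ∩ nb b ∩ nb c).card ≤ (nb a ∪ nb b ∪ nb c)ᶜ.card := by
    refine Finset.card_le_card_of_injOn anti (fun d hd => ?_)
      (fun x _ y _ hxy => by rw [← anti_anti x, hxy, anti_anti])
    simp only [Finset.coe_inter, Set.mem_inter_iff, Finset.mem_coe, mem_nb] at hd
    simp [mem_nb, rel_anti_right _ _ hd.1.1, rel_anti_right _ _ hd.1.2, rel_anti_right _ _ hd.2]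
  omega

theorem five_le_card_nb_inter_union {z a b : Fin 20} (hab : a ≠ b) (ha : a ≠ anti z)
    (hb : b ≠ anti z) : 5 ≤ (nb z ∩ (nb a ∪ nb b)).card := by
  by_cases haz : a = z
  · subst haz
    rw [Finset.inter_eq_left.2 Finset.subset_union_left, card_nb]
    norm_num
  by_cases hbz : b = z
  · subst hbz
    rw [Finset.inter_eq_left.2 Finset.subset_union_right, card_nb]
    norm_num
  have h1 := card_nb_inter haz ha
  have h2 := card_nb_inter hbz hb
  have h3 := Finset.card_union_add_card_inter (nb a ∩ nb z) (nb b ∩ nb z)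
  have h4 : nb a ∩ nb z ∩ (nb b ∩ nb z) = nb a ∩ nb b ∩ nb z := by
    ext; simp only [Finset.mem_inter]; tauto
  have h5 : nb a ∩ nb z ∪ nb b ∩ nb z = nb z ∩ (nb a ∪ nb b) := by
    ext; simp only [Finset.mem_inter, Finset.mem_union]; tauto
  have h6 : (nb a ∩ nb b ∩ nb z).card ≤ 2 := by
    by_cases hab' : a = anti b
    · have : nb a ∩ nb b = ∅ := by
        ext d
        simp only [Finset.mem_inter, mem_nb, Finset.notMem_empty, iff_false, not_and]
        intro h1 h2
        rw [rel_comm] at h1 h2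
        have := rel_anti_right _ _ h2
        rw [← hab', h1] at this
        exact absurd this (by simp)
      simp [this]
    · exact card_common_three_le hab haz hbz hab' ha hb
  rw [h4, h5, h1, h2] at h3
  omega

theorem exists_ne_and_ne_anti : ∀ a : Fin 20, ∃ b, a ≠ b ∧ a ≠ anti b := by decide +kernel

/-- The colours that have no neighbour (by an edge with sign `s`) in `P`. -/
def killed (s : Bool) (P : Finset (Fin 20)) : Finset (Fin 20) :=
  Finset.univ.filter fun c => ∀ p ∈ P, rel c (twist s p) = false

theorem mem_killed {s : Bool} {P : Finset (Fin 20)} {c : Fin 20} :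
    c ∈ killed s P ↔ ∀ p ∈ P, rel c (twist s p) = false := by simp [killed]

theorem killed_antitone {s : Bool} {P Q : Finset (Fin 20)} (h : P ⊆ Q) : killed s Q ⊆ killed s P :=
  fun _ hc => mem_killed.2 fun p hp => mem_killed.1 hc p (h hp)

theorem card_killed_inter_le {a b : Fin 20} (hab : a ≠ anti b) (s : Bool) {F : Finset (Fin 20)}
    (hF : F.card ≤ 1) : (killed s ((nb a ∩ nb b) \ F)).card ≤ 3 := by
  wlog hne : a ≠ b generalizing b
  · push Not at hne
    subst hne
    obtain ⟨b, h1, h2⟩ := exists_ne_and_ne_anti a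
    refine (Finset.card_le_card (killed_antitone ?_)).trans (this h2 h1)
    exact Finset.sdiff_subset_sdiff (by simp) subset_rfl
  have h3 : 3 ≤ ((nb a ∩ nb b) \ F).card := by
    have := Finset.le_card_sdiff F (nb a ∩ nb b)
    rw [card_nb_inter hne hab] at this
    omega
  obtain ⟨M, hM, hM3⟩ := Finset.exists_subset_card_eq h3
  obtain ⟨x, y, z, hxy, hxz, hyz, rfl⟩ := Finset.card_eq_three.1 hM3
  have hx := hM (show x ∈ _ by simp)
  have hy := hM (show y ∈ _ by simp)
  have hz := hM (show z ∈ _ by simp)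
  simp only [Finset.mem_sdiff, Finset.mem_inter, mem_nb] at hx hy hz
  have h5 := card_compl_union_three hxy hxz hyz (ne_anti_of_common a _ _ hx.1.1 hy.1.1)
    (ne_anti_of_common a _ _ hx.1.1 hz.1.1) (ne_anti_of_common a _ _ hy.1.1 hz.1.1)
  have h2 : ({a, b} : Finset _) ⊆ nb x ∩ nb y ∩ nb z := by
    intro c hc
    simp only [Finset.mem_insert, Finset.mem_singleton] at hc
    simp only [Finset.mem_inter, mem_nb, rel_comm _ c]
    rcases hc with rfl | rfl <;> tauto
  have h2' := Finset.card_le_card h2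
  rw [Finset.card_pair hne] at h2'
  have h6 : (killed s ((nb a ∩ nb b) \ F)).card ≤ (nb x ∪ nb y ∪ nb z)ᶜ.card := by
    refine Finset.card_le_card_of_injOn (twist s) (fun c hc => ?_) (twist_injective s).injOn
    have hc := killed_antitone hM hc
    simp only [mem_killed, ← rel_twist_left] at hc
    simp [mem_nb, rel_comm _ (twist s c), hc]
  omega

theorem le_card_erase_image_twist {S : Finset (Fin 20)} {n : ℕ} (h : n < S.card) (s : Bool)
    (z : Fin 20) :
    n ≤ ((S.image (twist s)).erase z).card := by
  have h1 := Finset.card_image_of_injective S (twist_injective s)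
  have h2 := Finset.pred_card_le_card_erase (s := S.image (twist s)) (a := z)
  omega

theorem card_killed_nb_le {z : Fin 20} (s : Bool) {F : Finset (Fin 20)}
    (hF : F.card ≤ 4) : (killed s (nb z \ F)).card ≤ 3 := by
  by_contra! h
  have h2 := le_card_erase_image_twist h s (anti z)
  obtain ⟨a, b, ha, hb, hab⟩ := Finset.one_lt_card_iff.1 (lt_of_lt_of_le (by norm_num) h2)
  simp only [Finset.mem_erase, Finset.mem_image, mem_killed] at ha hb
  have h3 : nb z ∩ (nb a ∪ nb b) ⊆ F := by
    intro p hp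
    by_contra hpF
    obtain ⟨-, c, hc, rfl⟩ := ha
    obtain ⟨-, d, hd, rfl⟩ := hb
    simp only [Finset.mem_inter, Finset.mem_union, mem_nb] at hp
    have hc := hc p (by simp [mem_nb, hp, hpF])
    have hd := hd p (by simp [mem_nb, hp, hpF])
    rw [← rel_twist_left] at hc hd
    simp [hc, hd] at hp
  have := Finset.card_le_card h3
  have := five_le_card_nb_inter_union hab ha.1 hb.1
  omega

/-- The colours with at most one neighbour (by an edge with sign `s`) in `P`. -/
def nearlyKilled (s : Bool) (P : Finset (Fin 20)) : Finset (Fin 20) :=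
  Finset.univ.filter fun c => (P.filter fun p => rel c (twist s p) = true).card ≤ 1

theorem card_nearlyKilled_le {z : Fin 20} (s : Bool) {F : Finset (Fin 20)}
    (hF : F.card ≤ 3) : (nearlyKilled s (nb z \ F)).card ≤ 3 := by
  by_contra! h
  have h2 := le_card_erase_image_twist h s (anti z)
  obtain ⟨K, hK, hK3⟩ := Finset.exists_subset_card_eq h2
  have key : ∀ c ∈ K, F ⊆ nb c ∩ nb z ∧ F.card = 3 := by
    intro c hc
    have := hK hc
    simp only [Finset.mem_erase, Finset.mem_image, nearlyKilled, Finset.mem_filter] at this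
    obtain ⟨hcz, d, ⟨-, hd⟩, rfl⟩ := this
    have h4 := four_le_card_nb_inter _ _ hcz
    have h5 : (nb (twist s d) ∩ nb z) \ F ⊆
        (nb z \ F).filter fun p => rel d (twist s p) = true := by
      intro p hp
      simp only [Finset.mem_sdiff, Finset.mem_inter, mem_nb, rel_twist_left] at hp
      simp [mem_nb, hp]
    have h5 := (Finset.card_le_card h5).trans hd
    have h6 := Finset.card_sdiff_add_card_inter (nb (twist s d) ∩ nb z) F
    have h7 : (nb (twist s d) ∩ nb z) ∩ F = F :=
      Finset.eq_of_subset_of_card_le Finset.inter_subset_right (by omega)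
    rw [h7] at h6
    exact ⟨Finset.inter_eq_right.1 h7, by omega⟩
  obtain ⟨c, hc⟩ := Finset.card_pos.1 (show 0 < K.card by omega)
  obtain ⟨x, y, w, hxy, hxw, hyw, rfl⟩ := Finset.card_eq_three.1 (key c hc).2
  have hx : ∀ c ∈ K, rel c x = true ∧ rel z x = true := fun c hc => by
    simpa [mem_nb] using (key c hc).1 (show x ∈ _ by simp)
  have hy : ∀ c ∈ K, rel c y = true ∧ rel z y = true := fun c hc => by
    simpa [mem_nb] using (key c hc).1 (show y ∈ _ by simp)
  have hw : ∀ c ∈ K, rel c w = true ∧ rel z w = true := fun c hc => by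
    simpa [mem_nb] using (key c hc).1 (show w ∈ _ by simp)
  have h8 := card_common_three_le hxy hxw hyw (ne_anti_of_common z _ _ (hx c hc).2 (hy c hc).2)
    (ne_anti_of_common z _ _ (hx c hc).2 (hw c hc).2)
    (ne_anti_of_common z _ _ (hy c hc).2 (hw c hc).2)
  have h9 : K ⊆ nb x ∩ nb y ∩ nb w := fun d hd => by
    simp only [Finset.mem_inter, mem_nb, rel_comm _ d]
    exact ⟨⟨(hx d hd).1, (hy d hd).1⟩, (hw d hd).1⟩
  have := Finset.card_le_card h9
  omega

theorem exists_notMem_killed {s : Bool} {P L : Finset (Fin 20)} {n : ℕ}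
    (hP : (killed s P).card ≤ n) (hL : n < L.card) :
    ∃ c ∈ L, ∃ p ∈ P, rel c (twist s p) = true := by
  obtain ⟨c, hc, hk⟩ := Finset.exists_mem_notMem_of_card_lt_card (hP.trans_lt hL)
  simp only [mem_killed, not_forall, Bool.not_eq_false] at hk
  obtain ⟨p, hp, h⟩ := hk
  exact ⟨c, hc, p, hp, h⟩

theorem exists_adjacent_pair {a b c d : Fin 20} (hab : a ≠ anti b) (hcd : c ≠ anti d) (s : Bool) :
    ∃ x ∈ nb a ∩ nb b, ∃ y ∈ nb c ∩ nb d, rel x (twist s y) = true := by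
  have h := card_killed_inter_le hcd s (F := ∅) (by simp)
  rw [Finset.sdiff_empty] at h
  exact exists_notMem_killed h (four_le_card_nb_inter _ _ hab)

theorem rel_anti_twist : ∀ (s : Bool) (y p : Fin 20), rel y p = true →
    rel (anti (twist s y)) (twist s p) = false := by
  decide +kernel

theorem not_rel_twist_anti : ∀ (a b : Bool) (x : Fin 20),
    rel (twist a x) (anti (twist b x)) = false := by
  decide +kernel

theorem exists_triangle (a b c : Fin 20) (r s t : Bool) {F G H : Finset (Fin 20)}
    (hF : F.card ≤ 2) (hG : G.card ≤ 1) (hH : H.card ≤ 1) :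
    ∃ x ∈ nb a \ F, ∃ p ∈ nb b \ G, ∃ q ∈ nb c \ H, rel x (twist r p) = true ∧
      rel x (twist s q) = true ∧ rel q (twist t p) = true := by
  obtain ⟨x, hx⟩ : ((nb a \ F) \ {twist r (anti b), twist s (anti c)}).Nonempty := by
    rw [← Finset.card_pos]
    have h1 := Finset.le_card_sdiff F (nb a)
    have h2 := Finset.le_card_sdiff {twist r (anti b), twist s (anti c)} (nb a \ F)
    have h3 := Finset.card_le_two (a := twist r (anti b)) (b := twist s (anti c))
    rw [card_nb] at h1
    omega
  simp only [Finset.mem_sdiff, Finset.mem_insert, Finset.mem_singleton, not_or] at hx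
  obtain ⟨hxF, hxb, hxc⟩ := hx
  have hb : twist r x ≠ anti b := fun h => hxb (by rw [← h, twist_self])
  have hc : twist s x ≠ anti c := fun h => hxc (by rw [← h, twist_self])
  have hk := card_killed_inter_le hb t hG
  have hQ : 3 ≤ ((nb (twist s x) ∩ nb c) \ H).card := by
    have := Finset.le_card_sdiff H (nb (twist s x) ∩ nb c)
    have := four_le_card_nb_inter _ _ hc
    omega
  have hlt : ((killed t ((nb (twist r x) ∩ nb b) \ G)).erase
      (anti (twist t (twist r x)))).card < ((nb (twist s x) ∩ nb c) \ H).card := by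
    rw [Finset.card_erase_of_mem]
    · omega
    · rw [mem_killed]
      intro p hp
      simp only [Finset.mem_sdiff, Finset.mem_inter, mem_nb] at hp
      exact rel_anti_twist _ _ _ hp.1.1
  obtain ⟨q, hq, hqk⟩ := Finset.exists_mem_notMem_of_card_lt_card hlt
  simp only [Finset.mem_sdiff, Finset.mem_inter, mem_nb] at hq
  have hq1 : q ≠ anti (twist t (twist r x)) := by
    rintro rfl
    rw [twist_twist, not_rel_twist_anti] at hq
    exact absurd hq.1.1 (by simp)
  simp only [Finset.mem_erase, ne_eq, hq1, not_false_eq_true, true_and, mem_killed, not_forall,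
    Bool.not_eq_false] at hqk
  obtain ⟨p, hp, hpq⟩ := hqk
  simp only [Finset.mem_sdiff, Finset.mem_inter, mem_nb, rel_twist_left] at hp hq
  exact ⟨x, Finset.mem_sdiff.2 hxF, p, by simp [mem_nb, hp], q, by simp [mem_nb, hq], hp.1.1,
    hq.1.1, hpq⟩

/-- Colours with a common neighbour, at most two of them, are among two colours that are not
antitwins. -/
theorem exists_pair_of_card_le_two {E : Finset (Fin 20)} (hE : E.card ≤ 2) {w : Fin 20}
    (hw : E ⊆ nb w) : ∃ a b, a ≠ anti b ∧ E ⊆ {a, b} := by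
  have h1 : ∀ a : Fin 20, a ≠ anti a := by decide
  rcases Nat.lt_or_ge 0 E.card with h0 | h0
  · obtain ⟨a, ha⟩ := Finset.card_pos.1 h0
    rcases (E.erase a).eq_empty_or_nonempty with h | ⟨b, hb⟩
    · exact ⟨a, a, h1 a, fun x hx => by
        by_contra hne
        exact Finset.notMem_empty x (h ▸ Finset.mem_erase.2 ⟨by simpa using hne, hx⟩)⟩
    · have hbE := Finset.mem_of_mem_erase hb
      refine ⟨a, b, ne_anti_of_common w _ _ (mem_nb.1 (hw ha)) (mem_nb.1 (hw hbE)), ?_⟩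
      have : {a, b} ⊆ E := by intro x; simp; rintro (rfl | rfl) <;> assumption
      rw [Finset.eq_of_subset_of_card_le this]
      rw [Finset.card_pair (Finset.ne_of_mem_erase hb).symm]
      exact hE
  · exact ⟨0, 0, h1 0, by simp [Finset.card_eq_zero.1 (by omega : E.card = 0)]⟩

theorem exists_common_of_card_le_three {E : Finset (Fin 20)} (hE : E.card ≤ 3)
    (h : ∀ a ∈ E, ∀ b ∈ E, a ≠ anti b) : ∃ w, ∀ e ∈ E, rel w e = true := by
  have key : ∀ a b c, a ∈ E → b ∈ E → c ∈ E → E ⊆ {a, b, c} → ∃ w, ∀ e ∈ E, rel w e = true := by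
    intro a b c ha hb hc hsub
    obtain ⟨w, h1, h2, h3⟩ := exists_common_three (h a ha b hb) (h a ha c hc) (h b hb c hc)
    refine ⟨w, fun e he => ?_⟩
    have := hsub he
    simp only [Finset.mem_insert, Finset.mem_singleton] at this
    rcases this with rfl | rfl | rfl <;> assumption
  obtain h0 | h0 | h0 | h0 : E.card = 0 ∨ E.card = 1 ∨ E.card = 2 ∨ E.card = 3 := by omega
  · exact ⟨0, by simp [Finset.card_eq_zero.1 h0]⟩
  · obtain ⟨a, rfl⟩ := Finset.card_eq_one.1 h0
    exact key a a a (by simp) (by simp) (by simp) (by simp)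
  · obtain ⟨a, b, -, rfl⟩ := Finset.card_eq_two.1 h0
    exact key a a b (by simp) (by simp) (by simp) (by simp)
  · obtain ⟨a, b, c, -, -, -, rfl⟩ := Finset.card_eq_three.1 h0
    exact key a b c (by simp) (by simp) (by simp) subset_rfl

theorem rel_twist_comm (s : Bool) (c d : Fin 20) : rel c (twist s d) = rel d (twist s c) := by
  rw [rel_comm, rel_twist_left]

theorem eq_or_eq_anti : ∀ (a b : Bool) (p q : Fin 20), twist a p = anti (twist b q) →
    p = q ∨ p = anti q := by
  decide +kernel

/-! ### Critical signed graphs -/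

section Critical

open Classical

variable {V : Type*}

/-- `φ` is a colouring of the signed graph with underlying graph `H` whose edges `uv` with
`sg u v = true` are negative. -/
def IsColouring (H : SimpleGraph V) (sg : V → V → Bool) (φ : V → Fin 20) : Prop :=
  ∀ u v, H.Adj u v → rel (φ u) (twist (sg u v) (φ v)) = true

/-- A signed graph that is not colourable and all of whose proper subgraphs are. -/
structure Critical (H : SimpleGraph V) (sg : V → V → Bool) : Prop where
  symm : ∀ u v, sg u v = sg v u
  not_colourable : ¬ ∃ φ, IsColouring H sg φ
  colourable_of_lt : ∀ H' < H, ∃ φ, IsColouring H' sg φ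

variable {H : SimpleGraph V} {sg : V → V → Bool}

theorem exists_colour_of_card_le_three {A : Finset V} {f : V → Fin 20} (hA : A.card ≤ 3)
    (h : ∀ a ∈ A, ∀ b ∈ A, f a ≠ anti (f b)) : ∃ c, ∀ a ∈ A, rel c (f a) = true := by
  obtain ⟨w, hw⟩ := exists_common_of_card_le_three (E := A.image f)
    (Finset.card_image_le.trans hA) (by
      simp only [Finset.mem_image]
      rintro _ ⟨a, ha, rfl⟩ _ ⟨b, hb, rfl⟩
      exact h a ha b hb)
  exact ⟨w, fun a ha => hw _ (Finset.mem_image_of_mem _ ha)⟩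

theorem Critical.exists_colouring_deleteEdge (hc : Critical H sg) {u v : V} (h : H.Adj u v) :
    ∃ φ : V → Fin 20, ∀ a b, H.Adj a b → s(a, b) ≠ s(u, v) →
      rel (φ a) (twist (sg a b) (φ b)) = true := by
  obtain ⟨φ, hφ⟩ := hc.colourable_of_lt (H.deleteEdges {s(u, v)})
    (lt_of_le_of_ne (SimpleGraph.deleteEdges_le _) fun he => by
      have := he ▸ h
      simp [SimpleGraph.deleteEdges_adj] at this)
  exact ⟨φ, fun a b hab hne => hφ a b (by simpa [SimpleGraph.deleteEdges_adj, hab] using hne)⟩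

variable [Fintype V]

noncomputable def nbrs (H : SimpleGraph V) (v : V) : Finset V := Finset.univ.filter (H.Adj v)

noncomputable def deg (H : SimpleGraph V) (v : V) : ℕ := (nbrs H v).card

def Big (H : SimpleGraph V) (v : V) : Prop := 4 ≤ deg H v

noncomputable def bigNbrs (H : SimpleGraph V) (v : V) : Finset V := (nbrs H v).filter (Big H)

noncomputable def smallNbrs (H : SimpleGraph V) (v : V) : Finset V :=
  (nbrs H v).filter fun w => ¬ Big H w

/-- The number of colours that the small neighbours of `v` may forbid at `v`. -/
noncomputable def load (H : SimpleGraph V) (v : V) : ℕ := ∑ t ∈ smallNbrs H v, (deg H t - 1)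

theorem mem_nbrs {v w : V} : w ∈ nbrs H v ↔ H.Adj v w := by simp [nbrs]

theorem mem_bigNbrs {v w : V} : w ∈ bigNbrs H v ↔ H.Adj v w ∧ Big H w := by
  simp [bigNbrs, mem_nbrs]

theorem mem_smallNbrs {v w : V} : w ∈ smallNbrs H v ↔ H.Adj v w ∧ ¬ Big H w := by
  simp [smallNbrs, mem_nbrs]

theorem card_bigNbrs_add_card_smallNbrs (H : SimpleGraph V) (v : V) :
    (bigNbrs H v).card + (smallNbrs H v).card = deg H v :=
  Finset.card_filter_add_card_filter_not _

theorem Critical.deg_ne_one (hc : Critical H sg) (v : V) : deg H v ≠ 1 := by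
  intro h1
  obtain ⟨a, ha⟩ := Finset.card_eq_one.1 h1
  have hva : H.Adj v a := mem_nbrs.1 (by simp [ha])
  have hav : ∀ b, H.Adj v b → b = a := fun b hb => by
    simpa [ha] using mem_nbrs.2 hb
  obtain ⟨φ, hφ⟩ := hc.exists_colouring_deleteEdge hva
  obtain ⟨x, hx⟩ := Finset.card_pos.1 (show 0 < (nb (twist (sg v a) (φ a))).card by
    rw [card_nb]; norm_num)
  rw [mem_nb, rel_comm] at hx
  refine hc.not_colourable ⟨fun w => if w = v then x else φ w, fun b c hbc => ?_⟩
  by_cases hb : b = v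
  · subst hb
    obtain rfl := hav c hbc
    simpa [hbc.ne'] using hx
  · by_cases hcv : c = v
    · subst hcv
      obtain rfl := hav b hbc.symm
      simp only [hb, if_false, if_true]
      rw [rel_twist_comm, hc.symm, hx]
    · simp only [hb, hcv, if_false]
      exact hφ b c hbc (by simp [hb, hcv])

theorem Critical.big_or_big (hc : Critical H sg) {u v : V} (h : H.Adj u v) :
    Big H u ∨ Big H v := by
  by_contra! hs
  obtain ⟨φ, hφ⟩ := hc.exists_colouring_deleteEdge h
  have key : ∀ x y, H.Adj x y → ¬ Big H x → s(x, y) = s(u, v) → ∃ a b, a ≠ anti b ∧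
      ∀ w, H.Adj x w → w ≠ y → twist (sg x w) (φ w) = a ∨ twist (sg x w) (φ w) = b := by
    intro x y hxy hx hs
    obtain ⟨a, b, hab, hE⟩ := exists_pair_of_card_le_two (w := φ x)
      (E := ((nbrs H x).erase y).image fun w => twist (sg x w) (φ w)) (by
        refine Finset.card_image_le.trans ?_
        rw [Finset.card_erase_of_mem (mem_nbrs.2 hxy)]
        simp only [Big, deg] at hx
        omega) (by
        intro c hcE
        simp only [Finset.mem_image, Finset.mem_erase, mem_nbrs] at hcE
        obtain ⟨w, ⟨hwy, hxw⟩, rfl⟩ := hcE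
        exact mem_nb.2 (hφ x w hxw (by
          rw [← hs]
          simp only [ne_eq, Sym2.eq_iff, true_and]
          rintro (h | ⟨-, rfl⟩)
          · exact hwy h
          · exact hxw.ne rfl)))
    refine ⟨a, b, hab, fun w hw hwy => ?_⟩
    simpa using hE (Finset.mem_image_of_mem _ (Finset.mem_erase.2 ⟨hwy, mem_nbrs.2 hw⟩))
  obtain ⟨a, b, hab, hu⟩ := key u v h hs.1 rfl
  obtain ⟨c, d, hcd, hv⟩ := key v u h.symm hs.2 Sym2.eq_swap
  obtain ⟨x, hx, y, hy, hxy⟩ := exists_adjacent_pair hab hcd (sg u v)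
  have hu : ∀ w, H.Adj u w → w ≠ v → rel x (twist (sg u w) (φ w)) = true := by
    intro w hw hwv
    simp only [Finset.mem_inter, mem_nb, rel_comm _ x] at hx
    rcases hu w hw hwv with h | h <;> simp [h, hx]
  have hv : ∀ w, H.Adj v w → w ≠ u → rel y (twist (sg v w) (φ w)) = true := by
    intro w hw hwv
    simp only [Finset.mem_inter, mem_nb, rel_comm _ y] at hy
    rcases hv w hw hwv with h | h <;> simp [h, hy]
  have huv := h.ne
  refine hc.not_colourable ⟨fun w => if w = u then x else if w = v then y else φ w,
    fun p q hpq => ?_⟩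
  have hpq' := hpq.ne
  by_cases hpu : p = u
  · subst hpu
    by_cases hqv : q = v
    · subst hqv
      simpa [hpq'.symm] using hxy
    · simpa [hpq'.symm, hqv] using hu q hpq hqv
  by_cases hpv : p = v
  · subst hpv
    by_cases hqu : q = u
    · subst hqu
      simp only [hpq', if_false, if_true]
      rw [rel_twist_comm, hc.symm, hxy]
    · simpa [hpu, hpq'.symm, hqu] using hv q hpq hqu
  by_cases hqu : q = u
  · subst hqu
    simp only [hpu, hpv, if_false, if_true]
    rw [rel_twist_comm, hc.symm]
    exact hu p hpq.symm hpv
  by_cases hqv : q = v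
  · subst hqv
    simp only [hpu, hpv, hqu, if_false, if_true]
    rw [rel_twist_comm, hc.symm]
    exact hv p hpq.symm hpu
  simp only [hpu, hpv, hqu, hqv, if_false]
  exact hφ p q hpq (by simp [hpu, hpv])

theorem Critical.false_of_big (hc : Critical H sg) {φ : V → Fin 20}
    (hbig : ∀ u v, H.Adj u v → Big H u → Big H v → rel (φ u) (twist (sg u v) (φ v)) = true)
    (hsmall : ∀ t, ¬ Big H t → ∀ a b, H.Adj t a → H.Adj t b → a ≠ b →
      twist (sg t a) (φ a) ≠ anti (twist (sg t b) (φ b))) : False := by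
  have hself : ∀ a : Fin 20, a ≠ anti a := by decide
  have key : ∀ t, ∃ c, ¬ Big H t → ∀ a ∈ nbrs H t, rel c (twist (sg t a) (φ a)) = true := by
    intro t
    by_cases ht : Big H t
    · exact ⟨0, fun h => absurd ht h⟩
    · obtain ⟨c, hc⟩ := exists_colour_of_card_le_three (A := nbrs H t)
        (f := fun a => twist (sg t a) (φ a)) (by simp only [Big, deg] at ht; omega) (by
          intro a ha b hb
          by_cases hab : a = b
          · subst hab
            exact hself _
          · exact hsmall t ht a b (mem_nbrs.1 ha) (mem_nbrs.1 hb) hab)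
      exact ⟨c, fun _ => hc⟩
  choose c hcol using key
  refine hc.not_colourable ⟨fun v => if Big H v then φ v else c v, fun u v huv => ?_⟩
  by_cases hu : Big H u
  · by_cases hv : Big H v
    · simpa [hu, hv] using hbig u v huv hu hv
    · simp only [hu, hv, if_true, if_false]
      rw [rel_twist_comm, hc.symm]
      exact hcol v hv u (mem_nbrs.2 huv.symm)
  · have hv := (hc.big_or_big huv).resolve_left hu
    simpa [hu, hv] using hcol u hu v (mem_nbrs.2 huv)

/-- `φ` colours everything except for the edges inside `S` and the edges from `S` to small
vertices. -/
def IsPartialColouring (H : SimpleGraph V) (sg : V → V → Bool) (S : Finset V)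
    (φ : V → Fin 20) : Prop :=
  ∀ u v, H.Adj u v → (u ∈ S → v ∉ S ∧ Big H v) → (v ∈ S → u ∉ S ∧ Big H u) →
    rel (φ u) (twist (sg u v) (φ v)) = true

theorem Critical.exists_isPartialColouring (hc : Critical H sg) {S : Finset V} {x y : V}
    (hx : x ∈ S) (hxy : H.Adj x y) (hy : y ∈ S ∨ ¬ Big H y) :
    ∃ φ, IsPartialColouring H sg S φ := by
  let H' : SimpleGraph V :=
    { Adj := fun u v => H.Adj u v ∧ (u ∈ S → v ∉ S ∧ Big H v) ∧ (v ∈ S → u ∉ S ∧ Big H u)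
      symm := ⟨fun u v h => ⟨h.1.symm, h.2.2, h.2.1⟩⟩
      loopless := ⟨fun u h => H.irrefl h.1⟩ }
  obtain ⟨φ, hφ⟩ := hc.colourable_of_lt H' (lt_of_le_of_ne (fun u v h => h.1) fun he => by
    have h1 : H'.Adj x y := by rw [he]; exact hxy
    have := h1.2.1 hx
    tauto)
  exact ⟨φ, fun u v h h1 h2 => hφ u v ⟨h, h1, h2⟩⟩

/-- The colours that are forbidden at `v` by the vertices outside `S` with which it has a common
small neighbour. -/
noncomputable def forbidden (H : SimpleGraph V) (sg : V → V → Bool) (S : Finset V)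
    (φ : V → Fin 20) (v : V) : Finset (Fin 20) :=
  (smallNbrs H v).biUnion fun t => (nbrs H t \ S).image fun b =>
    twist (sg t v) (anti (twist (sg t b) (φ b)))

/-- The colours that are available at `v` if the vertices of `S` are to be recoloured. -/
noncomputable def available (H : SimpleGraph V) (sg : V → V → Bool) (S : Finset V)
    (φ : V → Fin 20) (v : V) : Finset (Fin 20) :=
  (Finset.univ.filter fun c => ∀ a ∈ bigNbrs H v \ S, rel c (twist (sg v a) (φ a)) = true) \
    forbidden H sg S φ v

theorem Critical.false_of_available (hc : Critical H sg) {S : Finset V} {φ c : V → Fin 20}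
    (hφ : IsPartialColouring H sg S φ) (h1 : ∀ v ∈ S, c v ∈ available H sg S φ v)
    (h2 : ∀ v ∈ S, ∀ w ∈ S, H.Adj v w → rel (c v) (twist (sg v w) (c w)) = true)
    (h3 : ∀ v ∈ S, ∀ w ∈ S, v ≠ w → ¬ H.Adj v w → ∀ t, ¬ Big H t → H.Adj t v → H.Adj t w →
      twist (sg t v) (c v) ≠ anti (twist (sg t w) (c w))) : False := by
  have hanti : ∀ a b : Fin 20, a ≠ anti b → b ≠ anti a := fun a b h h' =>
    h (by rw [h', anti_anti])
  simp only [available, Finset.mem_sdiff, Finset.mem_filter, Finset.mem_univ, true_and,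
    mem_bigNbrs, and_imp, forbidden, Finset.mem_biUnion, Finset.mem_image, not_exists, not_and,
    mem_smallNbrs, mem_nbrs] at h1
  have h4 : ∀ v ∈ S, ∀ t, ¬ Big H t → H.Adj t v → ∀ b, H.Adj t b → b ∉ S →
      twist (sg t v) (c v) ≠ anti (twist (sg t b) (φ b)) := by
    intro v hv t ht htv b hb hbS he
    refine (h1 v hv).2 t htv.symm ht b hb hbS ?_
    rw [← he, twist_self]
  refine hc.false_of_big (φ := fun v => if v ∈ S then c v else φ v) ?_ ?_
  · intro u v huv hu hv
    by_cases huS : u ∈ S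
    · by_cases hvS : v ∈ S
      · simpa [huS, hvS] using h2 u huS v hvS huv
      · simpa [huS, hvS] using (h1 u huS).1 v huv hv hvS
    · by_cases hvS : v ∈ S
      · simp only [huS, hvS, if_true, if_false]
        rw [rel_twist_comm, hc.symm]
        exact (h1 v hvS).1 u huv.symm hu huS
      · simpa [huS, hvS] using hφ u v huv (fun h => absurd h huS) (fun h => absurd h hvS)
  · intro t ht a b hta htb hab
    by_cases haS : a ∈ S
    · by_cases hbS : b ∈ S
      · simp only [haS, hbS, if_true]
        by_cases hadj : H.Adj a b
        · exact twist_ne_anti_of_rel _ _ _ _ _ (h2 a haS b hbS hadj)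
        · exact h3 a haS b hbS hab hadj t ht hta htb
      · simpa [haS, hbS] using h4 a haS t ht hta b htb hbS
    · by_cases hbS : b ∈ S
      · simp only [haS, hbS, if_true, if_false]
        exact hanti _ _ (h4 b hbS t ht htb a hta haS)
      · simp only [haS, hbS, if_false]
        have hba := (hc.big_or_big hta).resolve_left ht
        have hbb := (hc.big_or_big htb).resolve_left ht
        have key : ∀ x, H.Adj t x → x ∉ S → rel (φ t) (twist (sg t x) (φ x)) = true := by
          intro x htx hx
          exact hφ t x htx (fun h => ⟨hx, (hc.big_or_big htx).resolve_left ht⟩)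
            (fun h => absurd h hx)
        exact ne_anti_of_common (φ t) _ _ (key a hta haS) (key b htb hbS)

theorem card_forbidden_le (φ : V → Fin 20) (S : Finset V) (v : V) :
    (forbidden H sg S φ v).card ≤ ∑ t ∈ smallNbrs H v, (nbrs H t \ S).card :=
  Finset.card_biUnion_le.trans (Finset.sum_le_sum fun _ _ => Finset.card_image_le)

theorem card_nbrs_sdiff_le {S : Finset V} {t v : V} (hv : v ∈ S) (h : t ∈ smallNbrs H v) :
    (nbrs H t \ S).card ≤ deg H t - 1 := by
  have hvt : v ∈ nbrs H t := mem_nbrs.2 (mem_smallNbrs.1 h).1.symm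
  rw [deg, ← Finset.card_erase_of_mem hvt]
  refine Finset.card_le_card fun w hw => ?_
  rw [Finset.mem_sdiff] at hw
  exact Finset.mem_erase.2 ⟨fun h => hw.2 (h ▸ hv), hw.1⟩

theorem card_forbidden_le_load (φ : V → Fin 20) {S : Finset V} {v : V} (hv : v ∈ S) :
    (forbidden H sg S φ v).card ≤ load H v :=
  (card_forbidden_le φ S v).trans (Finset.sum_le_sum fun _ h => card_nbrs_sdiff_le hv h)

theorem card_forbidden_lt_load (φ : V → Fin 20) {S : Finset V} {v w t : V} (hv : v ∈ S)
    (hw : w ∈ S) (hvw : v ≠ w) (ht : t ∈ smallNbrs H v) (htw : t ∈ smallNbrs H w) :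
    (forbidden H sg S φ v).card < load H v := by
  refine (card_forbidden_le φ S v).trans_lt
    (Finset.sum_lt_sum (fun _ h => card_nbrs_sdiff_le hv h) ⟨t, ht, ?_⟩)
  have hvt : v ∈ nbrs H t := mem_nbrs.2 (mem_smallNbrs.1 ht).1.symm
  have hwt : w ∈ nbrs H t := mem_nbrs.2 (mem_smallNbrs.1 htw).1.symm
  have h1 : (nbrs H t \ S).card + ({v, w} : Finset V).card ≤ (nbrs H t).card := by
    rw [← Finset.card_union_of_disjoint]
    · refine Finset.card_le_card (Finset.union_subset Finset.sdiff_subset ?_)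
      simp [Finset.insert_subset_iff, hvt, hwt]
    · rw [Finset.disjoint_left]
      simp only [Finset.mem_sdiff, Finset.mem_insert, Finset.mem_singleton]
      rintro a ⟨-, h⟩ (rfl | rfl) <;> contradiction
  rw [Finset.card_pair hvw] at h1
  rw [deg]
  omega

theorem available_of_singleton {φ : V → Fin 20} {S : Finset V} {v z : V}
    (h : bigNbrs H v \ S = {z}) :
    available H sg S φ v = nb (twist (sg v z) (φ z)) \ forbidden H sg S φ v := by
  rw [available, h]
  congr 1
  ext c
  simp [mem_nb, rel_comm _ c]

theorem available_of_pair {φ : V → Fin 20} {S : Finset V} {v y z : V}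
    (hφ : IsPartialColouring H sg S φ)
    (h : bigNbrs H v \ S = {y, z}) :
    twist (sg v y) (φ y) ≠ anti (twist (sg v z) (φ z)) ∧ available H sg S φ v =
      (nb (twist (sg v y) (φ y)) ∩ nb (twist (sg v z) (φ z))) \ forbidden H sg S φ v := by
  constructor
  · have key : ∀ w ∈ bigNbrs H v \ S, rel (φ v) (twist (sg v w) (φ w)) = true := by
      intro w hw
      rw [Finset.mem_sdiff, mem_bigNbrs] at hw
      exact hφ v w hw.1.1 (fun _ => ⟨hw.2, hw.1.2⟩) (fun h => absurd h hw.2)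
    rw [h] at key
    exact ne_anti_of_common (φ v) _ _ (key y (by simp)) (key z (by simp))
  · rw [available, h]
    congr 1
    ext c
    simp [mem_nb, rel_comm _ c]

theorem nine_le_card_available {φ : V → Fin 20} {S : Finset V} {v : V} (hv : v ∈ S)
    (h : (bigNbrs H v \ S).card = 1) : 9 ≤ (available H sg S φ v).card + load H v := by
  obtain ⟨z, hz⟩ := Finset.card_eq_one.1 h
  rw [available_of_singleton hz]
  have h1 := Finset.le_card_sdiff (forbidden H sg S φ v) (nb (twist (sg v z) (φ z)))
  have h2 := card_forbidden_le_load (sg := sg) φ hv (H := H)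
  rw [card_nb] at h1
  omega

theorem card_killed_available_le {φ : V → Fin 20} {S : Finset V} {v : V}
    (hφ : IsPartialColouring H sg S φ) (hv : v ∈ S)
    (h : (bigNbrs H v \ S).card = 2 ∧ load H v ≤ 1 ∨
      (bigNbrs H v \ S).card = 1 ∧ load H v ≤ 4) (s : Bool) :
    (killed s (available H sg S φ v)).card ≤ 3 := by
  have h2 := card_forbidden_le_load (sg := sg) φ hv (H := H)
  rcases h with ⟨h, hl⟩ | ⟨h, hl⟩
  · obtain ⟨y, z, -, hyz⟩ := Finset.card_eq_two.1 h
    obtain ⟨h3, h4⟩ := available_of_pair hφ hyz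
    rw [h4]
    exact card_killed_inter_le h3 s (by omega)
  · obtain ⟨z, hz⟩ := Finset.card_eq_one.1 h
    rw [available_of_singleton hz]
    exact card_killed_nb_le s (by omega)

theorem Critical.load_bound (hc : Critical H sg) {x : V} (hx : Big H x) :
    ((bigNbrs H x).card = 0 → 20 ≤ load H x) ∧ ((bigNbrs H x).card = 1 → 9 ≤ load H x) ∧
      ((bigNbrs H x).card = 2 → 4 ≤ load H x) := by
  have hsum := card_bigNbrs_add_card_smallNbrs H x
  have hbig : 4 ≤ deg H x := hx
  by_cases hm : (bigNbrs H x).card ≤ 2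
  swap
  · exact ⟨by omega, by omega, by omega⟩
  obtain ⟨t, ht⟩ := Finset.card_pos.1 (show 0 < (smallNbrs H x).card by omega)
  rw [mem_smallNbrs] at ht
  obtain ⟨φ, hφ⟩ := hc.exists_isPartialColouring (S := {x}) (by simp) ht.1 (Or.inr ht.2)
  have hS : bigNbrs H x \ {x} = bigNbrs H x := by
    rw [Finset.sdiff_singleton_eq_erase, Finset.erase_eq_of_notMem]
    simp [mem_bigNbrs]
  have hempty : (available H sg {x} φ x).card = 0 := by
    rw [Finset.card_eq_zero, Finset.eq_empty_iff_forall_notMem]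
    intro c hca
    refine hc.false_of_available (c := fun _ => c) hφ ?_ ?_ ?_
    · simpa using hca
    · simp
    · simp
  have hload := card_forbidden_le_load (sg := sg) (H := H) φ (Finset.mem_singleton_self x)
  refine ⟨fun h => ?_, fun h => ?_, fun h => ?_⟩
  · rw [available, hS, Finset.card_eq_zero.1 h] at hempty
    have := Finset.le_card_sdiff (forbidden H sg {x} φ x) Finset.univ
    simp only [Finset.notMem_empty, false_implies, implies_true, Finset.filter_true] at hempty
    rw [hempty] at this
    simp only [Finset.card_univ, Fintype.card_fin] at this
    omega
  · have := nine_le_card_available (sg := sg) (φ := φ) (Finset.mem_singleton_self x)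
      (H := H) (by rw [hS, h])
    omega
  · obtain ⟨y, z, -, hyz⟩ := Finset.card_eq_two.1 (hS ▸ h)
    obtain ⟨h3, h4⟩ := available_of_pair hφ hyz
    rw [h4] at hempty
    have := Finset.le_card_sdiff (forbidden H sg {x} φ x)
      (nb (twist (sg x y) (φ y)) ∩ nb (twist (sg x z) (φ z)))
    have := four_le_card_nb_inter _ _ h3
    omega

end Critical
/-! ### Weak vertices -/

section Discharging

open Classical

variable {V : Type*} {H : SimpleGraph V} {sg : V → V → Bool} [Fintype V]

/-- The vertices that receive charge from their big neighbours. -/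
def Weak (H : SimpleGraph V) (v : V) : Prop :=
  ((bigNbrs H v).card = 3 ∧ load H v = 1 ∧ deg H v = 4) ∨
    ((bigNbrs H v).card = 2 ∧ load H v = 4 ∧ deg H v = 6)

theorem Weak.big {v : V} (h : Weak H v) : Big H v := by
  rcases h with h | h <;> simp [Big, h]

theorem card_bigNbrs_sdiff_pair {v w : V} (h : w ∈ bigNbrs H v) :
    (bigNbrs H v \ {v, w}).card + 1 = (bigNbrs H v).card := by
  have : bigNbrs H v \ {v, w} = (bigNbrs H v).erase w := by
    ext u
    simp only [Finset.mem_sdiff, Finset.mem_insert, Finset.mem_singleton, Finset.mem_erase,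
      mem_bigNbrs]
    have := fun h : H.Adj v u => h.ne'
    tauto
  rw [this, Finset.card_erase_add_one h]

theorem Critical.not_weak_of_card_two (hc : Critical H sg) {x p : V} (hx : Big H x)
    (hm : (bigNbrs H x).card = 2) (hl : load H x ≤ 5) (hp : p ∈ bigNbrs H x) : ¬ Weak H p := by
  intro hw
  have hxp := (mem_bigNbrs.1 hp).1
  have hxp' := hxp.ne
  have hxb : x ∈ bigNbrs H p := mem_bigNbrs.2 ⟨hxp.symm, hx⟩
  obtain ⟨φ, hφ⟩ := hc.exists_isPartialColouring (S := {x, p}) (x := x) (y := p) (by simp) hxp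
    (by simp)
  have h1 := card_bigNbrs_sdiff_pair hp
  have h2 := card_bigNbrs_sdiff_pair hxb
  rw [Finset.pair_comm] at h2
  have h3 := nine_le_card_available (sg := sg) (φ := φ) (H := H) (S := {x, p}) (v := x) (by simp)
    (by omega)
  have h4 := card_killed_available_le hφ (v := p) (by simp) (by
    rcases hw with hw | hw
    · left; omega
    · right; omega) (sg x p)
  obtain ⟨c, hcx, d, hdp, hcd⟩ := exists_notMem_killed h4 (L := available H sg {x, p} φ x)
    (by omega)
  refine hc.false_of_available (c := fun v => if v = x then c else d) hφ ?_ ?_ ?_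
  · simp [hxp'.symm, hcx, hdp]
  · simp only [Finset.mem_insert, Finset.mem_singleton]
    rintro v (rfl | rfl) w (rfl | rfl) hvw
    · exact absurd rfl hvw.ne
    · simpa [hxp'.symm] using hcd
    · simp only [hxp'.symm, if_true, if_false]
      rw [rel_twist_comm, hc.symm, hcd]
    · exact absurd rfl hvw.ne
  · simp only [Finset.mem_insert, Finset.mem_singleton]
    rintro v (rfl | rfl) w (rfl | rfl) hne hvw <;> simp_all [H.adj_comm]

theorem eq_or_eq_anti_of_links {a b a' b' : Bool} {p p' q : Fin 20}
    (h : twist a p = anti (twist b q)) (h' : twist a' p' = anti (twist b' q)) :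
    p = p' ∨ p = anti p' := by
  rcases eq_or_eq_anti _ _ _ _ h with rfl | rfl <;>
    rcases eq_or_eq_anti _ _ _ _ h' with rfl | rfl <;> simp [anti_anti]

theorem card_bigNbrs_sdiff_triple {v w u : V} (h : w ∈ bigNbrs H v) (h' : u ∈ bigNbrs H v)
    (hwu : w ≠ u) : (bigNbrs H v \ {v, w, u}).card + 2 = (bigNbrs H v).card := by
  have : bigNbrs H v \ {v, w, u} = ((bigNbrs H v).erase w).erase u := by
    ext y
    simp only [Finset.mem_sdiff, Finset.mem_insert, Finset.mem_singleton, Finset.mem_erase,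
      mem_bigNbrs]
    have := fun h : H.Adj v y => h.ne'
    tauto
  have h1 := Finset.card_erase_add_one h
  have h2 := Finset.card_erase_add_one (Finset.mem_erase.2 ⟨hwu.symm, h'⟩)
  rw [this]
  omega

/-- A vertex `x` and two of its neighbours cannot be recoloured compatibly. -/
theorem Critical.false_of_triple (hc : Critical H sg) {x p q : V} (hxp : H.Adj x p)
    (hxq : H.Adj x q) (hpq : p ≠ q) {φ : V → Fin 20}
    (hφ : IsPartialColouring H sg {x, p, q} φ) {a b c : Fin 20}
    (ha : a ∈ available H sg {x, p, q} φ x) (hb : b ∈ available H sg {x, p, q} φ p)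
    (hc' : c ∈ available H sg {x, p, q} φ q) (hab : rel a (twist (sg x p) b) = true)
    (hac : rel a (twist (sg x q) c) = true)
    (hadj : H.Adj p q → rel c (twist (sg q p) b) = true)
    (hnadj : ¬ H.Adj p q → ∀ t, ¬ Big H t → H.Adj t p → H.Adj t q →
      twist (sg t p) b ≠ anti (twist (sg t q) c)) : False := by
  have hanti : ∀ a b : Fin 20, a ≠ anti b → b ≠ anti a := fun a b h h' =>
    h (by rw [h', anti_anti])
  have h1 := hxp.ne
  have h2 := hxq.ne
  refine hc.false_of_available (c := fun v => if v = x then a else if v = p then b else c)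
    hφ ?_ ?_ ?_
  · simp [h1.symm, h2.symm, hpq.symm, ha, hb, hc']
  · simp only [Finset.mem_insert, Finset.mem_singleton]
    rintro v (rfl | rfl | rfl) w (rfl | rfl | rfl) hvw
    · exact absurd rfl hvw.ne
    · simpa [h1.symm] using hab
    · simpa [h2.symm, hpq.symm] using hac
    · simp only [h1.symm, if_true, if_false]
      rw [rel_twist_comm, hc.symm, hab]
    · exact absurd rfl hvw.ne
    · simp only [h1.symm, h2.symm, hpq.symm, if_true, if_false]
      rw [rel_twist_comm, hc.symm, hadj hvw]
    · simp only [h2.symm, hpq.symm, if_true, if_false]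
      rw [rel_twist_comm, hc.symm, hac]
    · simpa [h1.symm, h2.symm, hpq.symm] using hadj hvw.symm
    · exact absurd rfl hvw.ne
  · simp only [Finset.mem_insert, Finset.mem_singleton]
    rintro v (rfl | rfl | rfl) w (rfl | rfl | rfl) hne hvw t ht htv htw
    · exact absurd rfl hne
    · exact absurd hxp hvw
    · exact absurd hxq hvw
    · exact absurd hxp.symm hvw
    · exact absurd rfl hne
    · simpa [h1.symm, h2.symm, hpq.symm] using hnadj hvw t ht htv htw
    · exact absurd hxq.symm hvw
    · simpa [h1.symm, h2.symm, hpq.symm] using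
        hanti _ _ (hnadj (fun h => hvw h.symm) t ht htw htv)
    · exact absurd rfl hne

variable {x p q : V}

theorem Critical.exists_partial_triple (hc : Critical H sg) (hxp : H.Adj x p) :
    ∃ φ, IsPartialColouring H sg {x, p, q} φ :=
  hc.exists_isPartialColouring (x := x) (y := p) (by simp) hxp (by simp)

theorem Critical.not_adj_of_weak (hc : Critical H sg) (hx : Big H x)
    (hm : (bigNbrs H x).card = 3) (hl : load H x ≤ 2) (hp : p ∈ bigNbrs H x)
    (hq : q ∈ bigNbrs H x) (hwp : Weak H p) (hwq : Weak H q) : ¬ H.Adj p q := by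
  intro hpq
  have hxp := (mem_bigNbrs.1 hp).1
  have hxq := (mem_bigNbrs.1 hq).1
  have key : ∀ {p q : V}, Weak H p → Weak H q → H.Adj p q →
      (bigNbrs H p).card = 3 ∧ load H p = 1 := by
    intro p q hwp hwq hpq
    rcases hwp with h | h
    · exact ⟨h.1, h.2.1⟩
    · exact absurd hwq (hc.not_weak_of_card_two (x := p) (Weak.big (Or.inr h)) h.1
        (by omega) (mem_bigNbrs.2 ⟨hpq, hwq.big⟩))
  obtain ⟨φ, hφ⟩ := hc.exists_partial_triple (q := q) hxp
  have h1 := card_bigNbrs_sdiff_triple hp hq hpq.ne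
  have h2 := card_bigNbrs_sdiff_triple (v := p) (w := x) (u := q)
    (mem_bigNbrs.2 ⟨hxp.symm, hx⟩) (mem_bigNbrs.2 ⟨hpq, hwq.big⟩) hxq.ne
  have h3 := card_bigNbrs_sdiff_triple (v := q) (w := x) (u := p)
    (mem_bigNbrs.2 ⟨hxq.symm, hx⟩) (mem_bigNbrs.2 ⟨hpq.symm, hwp.big⟩) hxp.ne
  rw [show ({p, x, q} : Finset V) = {x, p, q} from Finset.insert_comm _ _ _] at h2
  rw [show ({q, x, p} : Finset V) = {x, p, q} by
    rw [Finset.insert_comm, Finset.pair_comm]] at h3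
  have kp := key hwp hwq hpq
  have kq := key hwq hwp hpq.symm
  obtain ⟨z, hz⟩ := Finset.card_eq_one.1 (show (bigNbrs H x \ {x, p, q}).card = 1 by omega)
  obtain ⟨y, hy⟩ := Finset.card_eq_one.1 (show (bigNbrs H p \ {x, p, q}).card = 1 by omega)
  obtain ⟨w, hw⟩ := Finset.card_eq_one.1 (show (bigNbrs H q \ {x, p, q}).card = 1 by omega)
  have fx := card_forbidden_le_load (sg := sg) (H := H) (S := {x, p, q}) φ (v := x) (by simp)
  have fp := card_forbidden_le_load (sg := sg) (H := H) (S := {x, p, q}) φ (v := p) (by simp)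
  have fq := card_forbidden_le_load (sg := sg) (H := H) (S := {x, p, q}) φ (v := q) (by simp)
  obtain ⟨a, ha, b, hb, c, hc', hab, hac, hbc⟩ := exists_triangle (twist (sg x z) (φ z))
    (twist (sg p y) (φ y)) (twist (sg q w) (φ w)) (sg x p) (sg x q) (sg q p)
    (fx.trans hl) (fp.trans kp.2.le) (fq.trans kq.2.le)
  rw [← available_of_singleton hz] at ha
  rw [← available_of_singleton hy] at hb
  rw [← available_of_singleton hw] at hc'
  exact hc.false_of_triple hxp hxq hpq.ne hφ ha hb hc' hab hac (fun _ => hbc)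
    (fun h => absurd hpq h)

theorem card_bigNbrs_sdiff_of_not_adj (hx : x ∈ bigNbrs H p) (hpq : ¬ H.Adj p q) :
    (bigNbrs H p \ {x, p, q}).card + 1 = (bigNbrs H p).card := by
  rw [← card_bigNbrs_sdiff_pair hx]
  congr 2
  ext u
  simp only [Finset.mem_sdiff, Finset.mem_insert, Finset.mem_singleton, mem_bigNbrs]
  constructor
  · tauto
  · rintro ⟨h1, h2⟩
    refine ⟨h1, ?_⟩
    rintro (rfl | rfl | rfl)
    · simp at h2
    · simp at h2
    · exact hpq h1.1

theorem Critical.exists_link_of_weak (hc : Critical H sg) (hx : Big H x)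
    (hm : (bigNbrs H x).card = 3) (hl : load H x ≤ 2) (hp : p ∈ bigNbrs H x)
    (hq : q ∈ bigNbrs H x) (hpq : p ≠ q) (hwp : Weak H p) (hwq : Weak H q) :
    deg H p = 4 ∧ ∃ t, ¬ Big H t ∧ H.Adj t p ∧ H.Adj t q := by
  have hnadj := hc.not_adj_of_weak hx hm hl hp hq hwp hwq
  have hxp := (mem_bigNbrs.1 hp).1
  have hxq := (mem_bigNbrs.1 hq).1
  obtain ⟨φ, hφ⟩ := hc.exists_partial_triple (q := q) hxp
  have h1 := card_bigNbrs_sdiff_triple hp hq hpq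
  have h2 := card_bigNbrs_sdiff_of_not_adj (mem_bigNbrs.2 ⟨hxp.symm, hx⟩) hnadj
  have h3 := card_bigNbrs_sdiff_of_not_adj (mem_bigNbrs.2 ⟨hxq.symm, hx⟩)
    (fun h => hnadj h.symm)
  rw [show ({x, q, p} : Finset V) = {x, p, q} by rw [Finset.pair_comm]] at h3
  have hX := nine_le_card_available (sg := sg) (φ := φ) (H := H) (S := {x, p, q}) (v := x)
    (by simp) (by omega)
  have kq := card_killed_available_le hφ (v := q) (by simp) (by
    rcases hwq with hw | hw
    · left; omega
    · right; omega) (sg x q)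
  by_contra hcon
  by_cases hlink : ∃ t, ¬ Big H t ∧ H.Adj t p ∧ H.Adj t q
  · have hwp' := hwp.resolve_left fun h => hcon ⟨h.2.2, hlink⟩
    obtain ⟨t, ht, htp, htq⟩ := hlink
    have fp := card_forbidden_lt_load (sg := sg) φ (S := {x, p, q}) (by simp) (by simp) hpq
      (mem_smallNbrs.2 ⟨htp.symm, ht⟩) (mem_smallNbrs.2 ⟨htq.symm, ht⟩)
    obtain ⟨z, hz⟩ := Finset.card_eq_one.1 (show (bigNbrs H p \ {x, p, q}).card = 1 by omega)
    have kp := card_nearlyKilled_le (z := twist (sg p z) (φ z)) (sg x p)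
      (F := forbidden H sg {x, p, q} φ p) (by omega)
    rw [← available_of_singleton hz] at kp
    obtain ⟨a, ha, hka⟩ := Finset.exists_mem_notMem_of_card_lt_card
      (s := nearlyKilled (sg x p) (available H sg {x, p, q} φ p) ∪
        killed (sg x q) (available H sg {x, p, q} φ q)) (t := available H sg {x, p, q} φ x)
      ((Finset.card_union_le _ _).trans_lt (by omega))
    simp only [Finset.mem_union, mem_killed, not_or, not_forall, Bool.not_eq_false, nearlyKilled,
      Finset.mem_filter, Finset.mem_univ, true_and, not_le] at hka
    obtain ⟨hk1, c, hc', hac⟩ := hka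
    obtain ⟨b, b', hb, hb', hne⟩ := Finset.one_lt_card_iff.1 hk1
    rw [Finset.mem_filter] at hb hb'
    have hfin : ∀ b ∈ available H sg {x, p, q} φ p, rel a (twist (sg x p) b) = true →
        ∃ t, twist (sg t p) b = anti (twist (sg t q) c) := by
      intro b hb hab
      by_contra! hno
      exact hc.false_of_triple hxp hxq hpq hφ ha hb hc' hab hac (fun h => absurd h hnadj)
        fun _ t _ _ _ => hno t
    obtain ⟨t1, h1⟩ := hfin b hb.1 hb.2
    obtain ⟨t2, h2⟩ := hfin b' hb'.1 hb'.2
    rcases eq_or_eq_anti_of_links h1 h2 with h | h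
    · exact hne h
    · refine ne_anti_of_common (twist (sg x p) a) b b' ?_ ?_ h <;> rw [rel_twist_left]
      · exact hb.2
      · exact hb'.2
  · have kp := card_killed_available_le hφ (v := p) (by simp) (by
      rcases hwp with hw | hw
      · left; omega
      · right; omega) (sg x p)
    obtain ⟨a, ha, hka⟩ := Finset.exists_mem_notMem_of_card_lt_card
      (s := killed (sg x p) (available H sg {x, p, q} φ p) ∪
        killed (sg x q) (available H sg {x, p, q} φ q)) (t := available H sg {x, p, q} φ x)
      ((Finset.card_union_le _ _).trans_lt (by omega))
    simp only [Finset.mem_union, mem_killed, not_or, not_forall, Bool.not_eq_false] at hka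
    obtain ⟨⟨b, hb, hab⟩, c, hc', hac⟩ := hka
    exact hc.false_of_triple hxp hxq hpq hφ ha hb hc' hab hac (fun h => absurd h hnadj)
      fun _ t ht htp htq => absurd ⟨t, ht, htp, htq⟩ hlink

end Discharging
/-! ### Discharging -/

section Charge

open Classical

variable {V : Type*} {H : SimpleGraph V} {sg : V → V → Bool} [Fintype V]

theorem Critical.deg_small (hc : Critical H sg) {v t : V} (h : t ∈ smallNbrs H v) :
    deg H t = 2 ∨ deg H t = 3 := by
  rw [mem_smallNbrs] at h
  have h1 := hc.deg_ne_one t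
  have h2 : 0 < deg H t := Finset.card_pos.2 ⟨v, mem_nbrs.2 h.1.symm⟩
  have h3 := h.2
  simp only [Big] at h3
  omega

theorem Critical.card_smallNbrs_le_load (hc : Critical H sg) (v : V) :
    (smallNbrs H v).card ≤ load H v := by
  rw [load, Finset.card_eq_sum_ones]
  exact Finset.sum_le_sum fun t ht => by have := hc.deg_small ht; omega

theorem Critical.load_le (hc : Critical H sg) (v : V) :
    load H v ≤ 2 * (smallNbrs H v).card := by
  rw [load, mul_comm, ← smul_eq_mul]
  exact Finset.sum_le_card_nsmul _ _ _ fun t ht => by have := hc.deg_small ht; omega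

theorem Critical.card_weak_le_two (hc : Critical H sg) {x : V} (hx : Big H x)
    (hm : (bigNbrs H x).card = 3) (hl : load H x ≤ 2) :
    ((bigNbrs H x).filter (Weak H)).card ≤ 2 := by
  by_contra! h
  obtain ⟨p, q, r, hp, hq, hr, hpq, hpr, hqr⟩ := Finset.two_lt_card_iff.1 h
  rw [Finset.mem_filter] at hp hq hr
  obtain ⟨hd, t, ht, htp, htq⟩ := hc.exists_link_of_weak hx hm hl hp.1 hq.1 hpq hp.2 hq.2
  obtain ⟨-, t', ht', htp', htr⟩ := hc.exists_link_of_weak hx hm hl hp.1 hr.1 hpr hp.2 hr.2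
  have hw := hp.2.resolve_right (by omega)
  have hsum := card_bigNbrs_add_card_smallNbrs H p
  obtain ⟨u, hu⟩ := Finset.card_eq_one.1 (show (smallNbrs H p).card = 1 by omega)
  have h1 : t ∈ smallNbrs H p := mem_smallNbrs.2 ⟨htp.symm, ht⟩
  have h2 : t' ∈ smallNbrs H p := mem_smallNbrs.2 ⟨htp'.symm, ht'⟩
  have hload := hw.2.1
  rw [load, hu, Finset.sum_singleton] at hload
  rw [hu, Finset.mem_singleton] at h1 h2
  subst h1 h2
  have h3 : 2 < (nbrs H t').card := Finset.two_lt_card_iff.2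
    ⟨p, q, r, mem_nbrs.2 htp, mem_nbrs.2 htq, mem_nbrs.2 htr, hpq, hpr, hqr⟩
  rw [deg] at hload
  omega

/-- The charge that `v` sends to `w`. -/
noncomputable def give (H : SimpleGraph V) (v w : V) : ℤ :=
  if H.Adj v w then
    if deg H w = 2 then 21 else if deg H w = 3 then 4 else
      if Big H v ∧ ¬ Weak H v ∧ Weak H w then 3 else 0
  else 0

/-- The initial charge of `v`. -/
noncomputable def charge (H : SimpleGraph V) (v : V) : ℤ :=
  if deg H v = 0 then 0 else 30 * deg H v - 102

theorem sum_give_left (H : SimpleGraph V) (v : V) :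
    ∑ w, give H v w = ∑ w ∈ nbrs H v, give H v w := by
  rw [nbrs, Finset.sum_filter]
  exact Finset.sum_congr rfl fun w _ => by simp +contextual [give]

theorem sum_give_right (H : SimpleGraph V) (v : V) :
    ∑ w, give H w v = ∑ w ∈ nbrs H v, give H w v := by
  rw [nbrs, Finset.sum_filter]
  exact Finset.sum_congr rfl fun w _ => by simp +contextual [give, H.adj_comm]

theorem Critical.give_small (hc : Critical H sg) {v t : V} (h : t ∈ smallNbrs H v) :
    give H v t = 38 - 17 * ((deg H t - 1 : ℕ) : ℤ) := by
  have h1 := (mem_smallNbrs.1 h).1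
  rcases hc.deg_small h with h2 | h2 <;> simp [give, h1, h2]

theorem Big.deg_ne {v : V} (h : Big H v) : deg H v ≠ 0 ∧ deg H v ≠ 2 ∧ deg H v ≠ 3 := by
  simp only [Big] at h
  omega

theorem sum_nbrs (v : V) (f : V → ℤ) :
    ∑ w ∈ nbrs H v, f w = ∑ w ∈ bigNbrs H v, f w + ∑ w ∈ smallNbrs H v, f w :=
  (Finset.sum_filter_add_sum_filter_not _ _ _).symm

theorem Critical.sum_give_small (hc : Critical H sg) (v : V) :
    ∑ w ∈ smallNbrs H v, give H v w = 38 * (smallNbrs H v).card - 17 * load H v := by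
  rw [Finset.sum_congr rfl fun w hw => hc.give_small hw, Finset.sum_sub_distrib,
    Finset.sum_const, ← Finset.mul_sum, load]
  push_cast
  rw [nsmul_eq_mul, mul_comm]

theorem charge_bound {m s l k : ℕ} (h1 : s ≤ l) (h2 : l ≤ 2 * s) (hd : 4 ≤ m + s)
    (hl0 : m = 0 → 20 ≤ l) (hl1 : m = 1 → 9 ≤ l) (hl2 : m = 2 → 4 ≤ l)
    (hR2 : m = 2 → l ≤ 5 → k = 0) (hR3 : m = 3 → l ≤ 2 → k ≤ 2) (hk : k ≤ m)
    (hwA : ¬ (m = 3 ∧ l = 1)) (hwB : ¬ (m = 2 ∧ l = 4 ∧ s = 4)) :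
    102 + 38 * s + 3 * k ≤ 30 * (m + s) + 17 * l := by
  obtain rfl | rfl | rfl | rfl | h : m = 0 ∨ m = 1 ∨ m = 2 ∨ m = 3 ∨ 4 ≤ m := by omega
  · have := hl0 rfl
    omega
  · have := hl1 rfl
    omega
  · have := hl2 rfl
    by_cases h5 : l ≤ 5
    · have := hR2 rfl h5
      omega
    · omega
  · by_cases h5 : l ≤ 2
    · have := hR3 rfl h5
      omega
    · omega
  · omega

theorem Critical.final_charge_nonneg (hc : Critical H sg) (v : V) :
    0 ≤ charge H v - ∑ w, give H v w + ∑ w, give H w v := by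
  by_cases hv : Big H v
  · have hd := hv.deg_ne
    have hsum := card_bigNbrs_add_card_smallNbrs H v
    have h1 := hc.card_smallNbrs_le_load v
    have h2 := hc.load_le v
    obtain ⟨hl0, hl1, hl2⟩ := hc.load_bound hv
    have hk := Finset.card_filter_add_card_filter_not (s := bigNbrs H v) (Weak H)
    have hR2 : (bigNbrs H v).card = 2 → load H v ≤ 5 →
        ((bigNbrs H v).filter (Weak H)).card = 0 := by
      intro hm hl
      rw [Finset.card_eq_zero, Finset.filter_eq_empty_iff]
      exact fun p hp => hc.not_weak_of_card_two hv hm hl hp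
    have hR3 := hc.card_weak_le_two hv
    have hbig : 4 ≤ deg H v := hv
    rw [sum_give_left, sum_give_right, sum_nbrs, sum_nbrs, hc.sum_give_small, charge, if_neg hd.1]
    by_cases hw : Weak H v
    · have e1 : ∑ w ∈ bigNbrs H v, give H v w = 0 := Finset.sum_eq_zero fun w hw' => by
        have := (mem_bigNbrs.1 hw').2.deg_ne
        simp [give, this, hw]
      have e2 : ∑ w ∈ smallNbrs H v, give H w v = 0 := Finset.sum_eq_zero fun w hw' => by
        simp [give, hd, (mem_smallNbrs.1 hw').2]
      have e3 : ∑ w ∈ bigNbrs H v, give H w v =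
          3 * ((bigNbrs H v).filter fun w => ¬ Weak H w).card := by
        rw [Finset.card_filter]
        push_cast
        rw [Finset.mul_sum]
        refine Finset.sum_congr rfl fun w hw' => ?_
        rw [mem_bigNbrs] at hw'
        by_cases h : Weak H w <;> simp [give, hd, hw'.1.symm, hw'.2, hw, h]
      rw [e1, e2, e3]
      rcases hw with hw | hw
      · have := hR3 hw.1 (by omega)
        omega
      · have := hR2 hw.1 (by omega)
        omega
    · have e1 : ∑ w ∈ bigNbrs H v, give H v w = 3 * ((bigNbrs H v).filter (Weak H)).card := by
        rw [Finset.card_filter]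
        push_cast
        rw [Finset.mul_sum]
        refine Finset.sum_congr rfl fun w hw' => ?_
        rw [mem_bigNbrs] at hw'
        have := hw'.2.deg_ne
        by_cases h : Weak H w <;> simp [give, this, hw'.1, hv, hw, h]
      have e2 : ∑ w ∈ bigNbrs H v, give H w v = 0 := Finset.sum_eq_zero fun w _ => by
        simp [give, hd, hw]
      have e3 : ∑ w ∈ smallNbrs H v, give H w v = 0 := Finset.sum_eq_zero fun w _ => by
        simp [give, hd, hw]
      rw [e1, e2, e3]
      have := charge_bound h1 h2 (by omega) hl0 hl1 hl2 hR2 hR3 (Finset.card_filter_le _ _)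
        (fun h => hw (Or.inl ⟨h.1, h.2, by omega⟩))
        (fun h => hw (Or.inr ⟨h.1, h.2.1, by omega⟩))
      omega
  · have e1 : ∑ w, give H v w = 0 := Finset.sum_eq_zero fun w _ => by
      by_cases h : H.Adj v w
      · have := ((hc.big_or_big h).resolve_left hv).deg_ne
        simp [give, this, hv]
      · simp [give, h]
    rw [e1]
    by_cases h0 : deg H v = 0
    · simp only [charge, h0, if_true, sub_zero, zero_add]
      refine Finset.sum_nonneg fun w _ => ?_
      simp only [give]
      split_ifs <;> norm_num
    · have h1 := hc.deg_ne_one v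
      have h4 : ¬ 4 ≤ deg H v := hv
      rw [sum_give_right]
      obtain h2 | h2 : deg H v = 2 ∨ deg H v = 3 := by omega
      · rw [Finset.sum_congr rfl (g := fun _ => 21) fun w hw => by
          simp [give, (mem_nbrs.1 hw).symm, h2]]
        rw [Finset.sum_const, ← deg, charge, h2]
        norm_num
      · rw [Finset.sum_congr rfl (g := fun _ => 4) fun w hw => by
          simp [give, (mem_nbrs.1 hw).symm, h2]]
        rw [Finset.sum_const, ← deg, charge, h2]
        norm_num

theorem Critical.sum_charge_nonneg (hc : Critical H sg) : 0 ≤ ∑ v, charge H v := by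
  have h := Finset.sum_nonneg fun v (_ : v ∈ Finset.univ) => hc.final_charge_nonneg v
  rw [Finset.sum_add_distrib, Finset.sum_sub_distrib,
    Finset.sum_comm (f := fun v w => give H w v)] at h
  linarith

theorem exists_critical {G : SimpleGraph V} (hsymm : ∀ u v, sg u v = sg v u)
    (h : ¬ ∃ φ, IsColouring G sg φ) : ∃ H ≤ G, Critical H sg := by
  obtain ⟨H, hH, hmin⟩ := wellFounded_lt.has_min
    {H : SimpleGraph V | H ≤ G ∧ ¬ ∃ φ, IsColouring H sg φ} ⟨G, le_rfl, h⟩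
  exact ⟨H, hH.1, hsymm, hH.2, fun H' hlt => by
    by_contra hcon
    exact hmin H' ⟨hlt.le.trans hH.1, hcon⟩ hlt⟩

theorem exists_colouring_of_maxAverageDegree_lt {G : SimpleGraph V}
    (hG : G.maxAverageDegree < 17 / 5) (hsymm : ∀ u v, sg u v = sg v u) :
    ∃ φ, IsColouring G sg φ := by
  by_contra hcon
  obtain ⟨H, hHG, hc⟩ := exists_critical hsymm hcon
  obtain ⟨u, v, huv⟩ : ∃ u v, H.Adj u v := by
    by_contra! hno
    exact hc.not_colourable ⟨fun _ => 0, fun u v h => absurd h (hno u v)⟩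
  let S : G.Subgraph :=
    { verts := H.support
      Adj := H.Adj
      adj_sub := fun h => hHG h
      edge_vert := fun h => ⟨_, h⟩
      symm := ⟨fun _ _ h => h.symm⟩ }
  have hS : S.averageDegree < 17 / 5 := lt_of_le_of_lt
    (le_ciSup (f := fun T : {T : G.Subgraph // T.verts.Nonempty} => T.1.averageDegree)
      (Set.finite_range _).bddAbove ⟨S, u, v, huv⟩) hG
  have hE : S.edgeSet.ncard = H.edgeFinset.card := by
    rw [← Set.ncard_coe_finset]
    congr 1
    ext e
    induction e with
    | _ a b => simp [S]
  have hdeg : ∀ w, deg H w = H.degree w := fun w => by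
    rw [deg, ← SimpleGraph.card_neighborFinset_eq_degree]
    congr 1
    ext
    simp [mem_nbrs]
  have hV : S.verts.ncard = (Finset.univ.filter fun w => deg H w ≠ 0).card := by
    rw [← Set.ncard_coe_finset]
    congr 1
    ext w
    simp only [S, SimpleGraph.mem_support, Finset.coe_filter, Finset.mem_univ, true_and,
      Set.mem_ofPred_eq, deg, ne_eq, Finset.card_eq_zero, ← Finset.nonempty_iff_ne_empty,
      Finset.Nonempty, mem_nbrs]
  have hpos : 0 < (Finset.univ.filter fun w => deg H w ≠ 0).card := by
    rw [Finset.card_pos]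
    exact ⟨u, by simpa [deg, ← Finset.nonempty_iff_ne_empty] using ⟨v, mem_nbrs.2 huv⟩⟩
  have hsum : ∑ w, charge H w = 30 * (2 * H.edgeFinset.card : ℕ) -
      102 * (Finset.univ.filter fun w => deg H w ≠ 0).card := by
    rw [← H.sum_degrees_eq_twice_card_edges, Finset.card_filter]
    push_cast
    rw [Finset.mul_sum, Finset.mul_sum, ← Finset.sum_sub_distrib]
    refine Finset.sum_congr rfl fun w _ => ?_
    rw [← hdeg, charge]
    by_cases h : deg H w = 0 <;> simp [h]
  have h0 := hc.sum_charge_nonneg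
  rw [hsum] at h0
  rw [SimpleGraph.Subgraph.averageDegree, hE, hV, div_lt_iff₀ (by exact_mod_cast hpos)] at hS
  have h0' : (0 : ℝ) ≤ 30 * (2 * H.edgeFinset.card : ℕ) -
      102 * (Finset.univ.filter fun w => deg H w ≠ 0).card := by exact_mod_cast h0
  push_cast at h0'
  linarith

end Charge
end SignedColour

/-! ### From colourings to homomorphisms -/

namespace SignedGraph

theorem edgeSign_symm {V : Type u} (G : SignedGraph V) {a b : V} (h : G.graph.Adj a b) :
    G.edgeSign h.symm = G.edgeSign h := by
  unfold edgeSign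
  congr 2
  exact Sym2.eq_swap

/-- `f` is a homomorphism of signed graphs after switching `G` at the vertices with `ε v = true`. -/
def IsSwitchHom {V : Type u} {W : Type v} (G : SignedGraph V) (H : SignedGraph W) (f : V → W)
    (ε : V → Bool) : Prop :=
  ∀ a b (h : G.graph.Adj a b), ∃ h' : H.graph.Adj (f a) (f b),
    decide (H.edgeSign h' = -1) = xor (decide (G.edgeSign h = -1)) (xor (ε a) (ε b))

theorem IsSwitchHom.homTo {V : Type u} {W : Type v} {G : SignedGraph V} {H : SignedGraph W}
    {f : V → W} {ε : V → Bool} (hf : IsSwitchHom G H f ε) : G.HomTo H := by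
  let φ : G.graph →g H.graph := ⟨f, fun h => (hf _ _ h).1⟩
  refine ⟨φ, ?_⟩
  have key : ∀ (a b : V) (p : G.graph.Walk a b),
      (Even (H.negCount (p.map φ)) ↔ (Even (G.negCount p) ↔ ε a = ε b)) := by
    intro a b p
    induction p with
    | nil => simp [negCount]
    | @cons a c b h p ih =>
      obtain ⟨h', he⟩ := hf a c h
      change Even ((if H.edgeSign h' = -1 then 1 else 0) + H.negCount (p.map φ)) ↔ _
      rw [negCount, Nat.even_add, Nat.even_add, ih]
      by_cases h1 : H.edgeSign h' = -1 <;> by_cases h2 : G.edgeSign h = -1 <;>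
        cases ha : ε a <;> cases hb : ε b <;> cases hc : ε c <;>
        simp [h1, h2, ha, hc] at he ⊢
  intro a p
  rw [IsBalanced, IsBalanced, key]
  simp

theorem exists_homTo_of_equiv {V : Type u} {W : Type v} {W' : Type w} {G : SignedGraph V}
    {H : SignedGraph W} {f : V → W} {ε : V → Bool} (hf : IsSwitchHom G H f ε) (e : W' ≃ W) :
    ∃ H' : SignedGraph W', G.HomTo H' := by
  obtain ⟨f, rfl⟩ : ∃ f', f = e ∘ f' := ⟨e.symm ∘ f, by ext; simp⟩
  let H' : SignedGraph W' :=
    { graph := H.graph.comap e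
      sign := fun x => H.sign ⟨x.1.map e, by
        obtain ⟨x, hx⟩ := x
        induction x with
        | _ a b => exact hx⟩ }
  refine ⟨H', IsSwitchHom.homTo (f := f) (ε := ε) fun a b h => ?_⟩
  obtain ⟨h', he⟩ := hf a b h
  exact ⟨h', he⟩

theorem edgeSign_plus_some {V : Type u} (G : SignedGraph V) {a b : V}
    (h : G.plus.graph.Adj (some a) (some b)) :
    G.plus.edgeSign h = -1 ↔ G.edgeSign (show G.graph.Adj a b from h) = -1 := by
  unfold edgeSign plus
  dsimp only
  split_ifs with hex
  · simp only [true_iff]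
    obtain ⟨c, d, hcd, he, hs⟩ := hex
    have : s(c, d) = s(a, b) := by
      simpa [Sym2.eq_iff, eq_comm] using he
    rw [← hs]
    unfold edgeSign
    congr 2
    exact this.symm
  · refine iff_of_false (by decide) fun hs => hex ⟨a, b, h, rfl, hs⟩

theorem edgeSign_plus_none {V : Type u} (G : SignedGraph V) {a : V}
    (h : G.plus.graph.Adj none (some a)) : G.plus.edgeSign h ≠ -1 := by
  unfold edgeSign plus
  dsimp only
  rw [if_neg]
  · decide
  · rintro ⟨c, d, -, he, -⟩
    simp at he

theorem edgeSign_paley {F : Type u} [Field F] [Fintype F] (hF : Fintype.card F % 4 = 1) {a b : F}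
    (h : (paley F hF).graph.Adj a b) : (paley F hF).edgeSign h = -1 ↔ ¬ IsSquare (a - b) := by
  unfold edgeSign paley
  dsimp only [Sym2.lift_mk]
  split_ifs with hs
  · exact iff_of_false (by decide) (by simpa using hs)
  · simpa using hs

/-- The field with nine elements as `𝔽₃[i]`. -/
theorem exists_F9_coordinates : ∃ e : ZMod 3 × ZMod 3 → F9, Function.Bijective e ∧
    ∀ x y, IsSquare (e x - e y) ↔ (x - y).1 = 0 ∨ (x - y).2 = 0 := by
  obtain ⟨i, hi⟩ : IsSquare (-1 : F9) := FiniteField.isSquare_neg_one_iff.2 (by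
    rw [card_F9]; norm_num)
  let f := algebraMap (ZMod 3) F9
  let e : ZMod 3 × ZMod 3 → F9 := fun x => f x.1 + f x.2 * i
  have hsub : ∀ x y, e x - e y = e (x - y) := fun x y => by
    simp only [e, Prod.fst_sub, Prod.snd_sub, map_sub]
    ring
  have hmul : ∀ x, e x * e x = e (x.1 * x.1 - x.2 * x.2, 2 * x.1 * x.2) := fun x => by
    simp only [e, map_sub, map_mul, map_ofNat]
    linear_combination -(f x.2 * f x.2) * hi
  have hinj : Function.Injective e := by
    intro x y hxy
    have h0 : e (x - y) = 0 := by rw [← hsub, hxy, sub_self]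
    have h1 : f ((x - y).1 * (x - y).1 + (x - y).2 * (x - y).2) = 0 := by
      simp only [e] at h0
      simp only [map_add, map_mul]
      linear_combination (f (x - y).1 - f (x - y).2 * i) * h0 - f (x - y).2 * f (x - y).2 * hi
    have h2 := (map_eq_zero f).1 h1
    have h3 : ∀ a b : ZMod 3, a * a + b * b = 0 → a = 0 ∧ b = 0 := by decide
    exact sub_eq_zero.1 (Prod.ext (h3 _ _ h2).1 (h3 _ _ h2).2)
  have hbij : Function.Bijective e := by
    rw [Fintype.bijective_iff_injective_and_card]
    exact ⟨hinj, by rw [card_F9]; rfl⟩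
  refine ⟨e, hbij, fun x y => ?_⟩
  rw [hsub]
  generalize x - y = z
  constructor
  · rintro ⟨r, hr⟩
    obtain ⟨w, rfl⟩ := hbij.2 r
    rw [hmul] at hr
    rw [hinj hr]
    have : ∀ a b : ZMod 3, a * a - b * b = 0 ∨ 2 * a * b = 0 := by decide
    exact this _ _
  · intro hz
    have : ∀ z : ZMod 3 × ZMod 3, z.1 = 0 ∨ z.2 = 0 →
        ∃ w : ZMod 3 × ZMod 3, z = (w.1 * w.1 - w.2 * w.2, 2 * w.1 * w.2) := by decide
    obtain ⟨w, rfl⟩ := this z hz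
    exact ⟨e w, (hmul w).symm⟩

end SignedGraph

namespace SignedColour

/-- The coordinates over `𝔽₃` of the position of a colour, if it is finite. -/
def coord (c : Fin 20) : ZMod 3 × ZMod 3 :=
  (((c % 10 / 3 : ℕ) : ZMod 3), ((c % 10 % 3 : ℕ) : ZMod 3))

/-- The position of the colour `c` is the vertex that is added to `SP₉`. -/
def atInfinity (c : Fin 20) : Bool := (c : ℕ) % 10 == 9

/-- The sign of the colour `c` is negative. -/
def isNeg (c : Fin 20) : Bool := decide (10 ≤ (c : ℕ))

theorem rel_spec : ∀ (s : Bool) (c d : Fin 20), rel c (twist s d) = true →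
    (atInfinity c = true ∧ atInfinity d = false ∧ xor s (xor (isNeg c) (isNeg d)) = false) ∨
    (atInfinity c = false ∧ atInfinity d = true ∧ xor s (xor (isNeg c) (isNeg d)) = false) ∨
    (atInfinity c = false ∧ atInfinity d = false ∧ coord c ≠ coord d ∧
      (xor s (xor (isNeg c) (isNeg d)) = true ↔
        ¬ ((coord c - coord d).1 = 0 ∨ (coord c - coord d).2 = 0))) := by
  decide +kernel

end SignedColour

namespace SignedGraph

open SignedColour in
theorem exists_isSwitchHom_SP9plus {V : Type u} [Finite V] (G : SignedGraph V)
    (hG : G.graph.maxAverageDegree < 17 / 5) : ∃ f ε, IsSwitchHom G SP9plus f ε := by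
  classical
  have := Fintype.ofFinite V
  let sg : V → V → Bool := fun a b =>
    if h : G.graph.Adj a b then decide (G.edgeSign h = -1) else false
  have hsg : ∀ a b, sg a b = sg b a := fun a b => by
    by_cases h : G.graph.Adj a b
    · simp only [sg, h, h.symm, dif_pos]
      rw [G.edgeSign_symm h]
    · simp [sg, h, mt SimpleGraph.Adj.symm h]
  obtain ⟨φ, hφ⟩ := exists_colouring_of_maxAverageDegree_lt hG hsg
  obtain ⟨e, he, hsq⟩ := exists_F9_coordinates
  let pos : Fin 20 → Option F9 := fun c => if atInfinity c then none else some (e (coord c))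
  refine ⟨fun v => pos (φ v), fun v => isNeg (φ v), fun a b h => ?_⟩
  have hs : sg a b = decide (G.edgeSign h = -1) := by simp [sg, h]
  have hrel := rel_spec _ _ _ (hφ a b h)
  rw [hs] at hrel
  beta_reduce
  rcases hrel with ⟨ha, hb, hx⟩ | ⟨ha, hb, hx⟩ | ⟨ha, hb, hne, hx⟩
  · have h1 : pos (φ a) = none := by simp [pos, ha]
    have h2 : pos (φ b) = some (e (coord (φ b))) := by simp [pos, hb]
    rw [h1, h2, hx]
    have hadj : SP9plus.graph.Adj none (some (e (coord (φ b)))) := trivial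
    exact ⟨hadj, decide_eq_false (edgeSign_plus_none _ hadj)⟩
  · have h1 : pos (φ a) = some (e (coord (φ a))) := by simp [pos, ha]
    have h2 : pos (φ b) = none := by simp [pos, hb]
    rw [h1, h2, hx]
    have hadj : SP9plus.graph.Adj none (some (e (coord (φ a)))) := trivial
    refine ⟨hadj.symm, ?_⟩
    rw [edgeSign_symm _ hadj]
    exact decide_eq_false (edgeSign_plus_none _ hadj)
  · have h1 : pos (φ a) = some (e (coord (φ a))) := by simp [pos, ha]
    have h2 : pos (φ b) = some (e (coord (φ b))) := by simp [pos, hb]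
    rw [h1, h2]
    have hadj : SP9plus.graph.Adj (some (e (coord (φ a)))) (some (e (coord (φ b)))) :=
      fun h => hne (he.1 h)
    refine ⟨hadj, ?_⟩
    rw [Bool.eq_iff_iff, hx, decide_eq_true_iff, ← hsq]
    exact (edgeSign_plus_some _ hadj).trans (edgeSign_paley _ _)

end SignedGraph

theorem theorem2 :
    (∀ (V : Type u) [Finite V] (G : SignedGraph V),
      G.graph.maxAverageDegree < 17 / 5 → G.HomTo SignedGraph.SP9plus) ∧
    SignedGraph.classChromaticNumber.{u} (SignedGraph.MadLT (17 / 5)) ≤ 10 := by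
  constructor
  · intro V _ G hG
    obtain ⟨f, ε, h⟩ := SignedGraph.exists_isSwitchHom_SP9plus G hG
    exact h.homTo
  · refine iSup_le fun V => iSup_le fun _ => iSup_le fun G => iSup_le fun hG => ?_
    obtain ⟨f, ε, h⟩ := SignedGraph.exists_isSwitchHom_SP9plus G hG
    have hcard : Fintype.card (Option SignedGraph.F9) = 10 := by
      rw [Fintype.card_option, SignedGraph.card_F9]
    exact iInf₂_le (10 : ℕ)
      (SignedGraph.exists_homTo_of_equiv h (Fintype.equivFinOfCardEq hcard).symm)
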